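/- For a finite simple graph $G=(V,E)$ without isolated vertices, a total dominating set of $G$ is a set $S\subseteq V$ such that every vertex of $G$ is adjacent to a vertex in $S$; it is minimal if no proper subset of $S$ is a total dominating set. Let $\Gamma_t(G)$ be the maximum cardinality of a minimal total dominating set of $G$. For an integer $k\ge 0$, let $D_k^t(G)$ be the graph whose vertices are the total dominating sets of $G$ of cardinality at most $k$, two of them being adjacent if and only if one is obtained from the other by adding a single vertex. Let $d_0(G)$ be the smallest integer $\ell\ge 0$ such that $D_k^t(G)$ is connected for all $k\ge\ell$, where the graph with no vertices is not regarded as connected. Let $P_n$ denote the path on $n$ vertices. Then $d_0(P_2)=\Gamma_t(P_2)=d_0(P_4)=\Gamma_t(P_4)=2$, and $d_0(P_n)=\Gamma_t(P_n)+1$ for $n=3$ and for every $n\ge 5$. -/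

import Mathlib

namespace TotalDom

/-- `S` is a total dominating set of `G`: every vertex of `G` (including the vertices of `S`)
is adjacent to a vertex in `S`. -/
def IsTDS {V : Type*} (G : SimpleGraph V) (S : Finset V) : Prop :=
  ∀ v : V, ∃ u ∈ S, G.Adj v u

/-- `S` is a minimal total dominating set: a total dominating set no proper subset of which is
a total dominating set. -/
def IsMTDS {V : Type*} (G : SimpleGraph V) (S : Finset V) : Prop :=
  IsTDS G S ∧ ∀ T : Finset V, T ⊂ S → ¬ IsTDS G T

/-- The upper total domination number: the maximum cardinality of a minimal total dominating set.
(For a finite graph without isolated vertices the maximum is attained,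
see `upperTotalDomNum_isGreatest`.) -/
noncomputable def upperTotalDomNum {V : Type*} [Fintype V] (G : SimpleGraph V) : ℕ :=
  sSup {m : ℕ | ∃ S : Finset V, IsMTDS G S ∧ S.card = m}

/-- The `k`-total dominating graph of `G`: its vertices are the total dominating sets of `G` of
cardinality at most `k`, two of them being adjacent iff one is obtained from the other by adding
a single vertex. -/
def kTotalDomGraph {V : Type*} [DecidableEq V] (G : SimpleGraph V) (k : ℕ) :
    SimpleGraph {S : Finset V // IsTDS G S ∧ S.card ≤ k} where
  Adj A B := ∃ v : V, (v ∉ A.1 ∧ B.1 = insert v A.1) ∨ (v ∉ B.1 ∧ A.1 = insert v B.1)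
  symm := ⟨fun _ _ ⟨v, h⟩ => ⟨v, h.symm⟩⟩
  loopless := ⟨fun A ⟨v, h⟩ => by
    have key : ¬ (v ∉ A.1 ∧ A.1 = insert v A.1) := fun ⟨h1, h2⟩ =>
      h1 (h2 ▸ Finset.mem_insert_self v A.1)
    exact h.elim key key⟩

/-- `d₀(G)`: the smallest `l` such that the `k`-total dominating graph of `G` is connected for all
`k ≥ l`. A connected graph has at least one vertex here (`SimpleGraph.Connected`). -/
noncomputable def dZero {V : Type*} [Fintype V] [DecidableEq V] (G : SimpleGraph V) : ℕ :=
  sInf {l : ℕ | ∀ k : ℕ, l ≤ k → (kTotalDomGraph G k).Connected}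

theorem upperTotalDomNum_isGreatest {V : Type*} [Fintype V] (G : SimpleGraph V)
    (hG : ∀ v : V, ∃ u : V, G.Adj v u) :
    IsGreatest {m : ℕ | ∃ S : Finset V, IsMTDS G S ∧ S.card = m} (upperTotalDomNum G) := by
  classical
  have hbdd : BddAbove {m : ℕ | ∃ S : Finset V, IsMTDS G S ∧ S.card = m} :=
    ⟨Fintype.card V, by rintro m ⟨S, -, rfl⟩; exact Finset.card_le_univ S⟩
  have hne : {m : ℕ | ∃ S : Finset V, IsMTDS G S ∧ S.card = m}.Nonempty := by
    have huniv : IsTDS G (Finset.univ : Finset V) := fun v =>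
      (hG v).imp fun u hu => ⟨Finset.mem_univ u, hu⟩
    obtain ⟨S, -, hS⟩ := exists_minimal_le_of_wellFoundedLT (IsTDS G) _ huniv
    exact ⟨S.card, S, ⟨hS.prop, fun T hT h => hS.not_lt h hT⟩, rfl⟩
  exact ⟨Nat.sSup_mem hne hbdd, fun m hm => le_csSup hbdd hm⟩

end TotalDom

open SimpleGraph

namespace TotalDom

/-! ### Minimal total dominating sets and connectivity in a general graph -/

section General

variable {V : Type*} {G : SimpleGraph V} {S T : Finset V} {k : ℕ}

/-! Lower bound: at `k = Γ_t` a maximum minimal set is an isolated vertex, so a second minimal set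
disconnects the graph (`not_connected_upperTotalDomNum`). Upper bound: for `k > Γ_t`, every total
dominating set of the path descends to `rightmostTDS` by deleting vertices or moving one two places
right (`exists_shift`). A move is an insertion followed by a deletion; it is needed only at minimal
sets, which leave room for one more vertex. For `n = 2, 4` the neighbours of the two leaves form a
least total dominating set. -/

theorem IsTDS.mono (h : IsTDS G S) (hST : S ⊆ T) : IsTDS G T := fun v =>
  (h v).imp fun _ hu => ⟨hST hu.1, hu.2⟩

theorem IsTDS.exists_isMTDS_subset (h : IsTDS G S) : ∃ T ⊆ S, IsMTDS G T := by
  obtain ⟨T, hTS, hT⟩ := exists_minimal_le_of_wellFoundedLT (IsTDS G) _ h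
  exact ⟨T, hTS, hT.prop, fun U hU h => hT.not_lt h hU⟩

theorem IsMTDS.card_le_upperTotalDomNum [Fintype V] (h : IsMTDS G S) :
    S.card ≤ upperTotalDomNum G :=
  (upperTotalDomNum_isGreatest G fun v => (h.1 v).imp fun _ hu => hu.2).2 ⟨S, h, rfl⟩

theorem IsTDS.exists_erase [DecidableEq V] (h : IsTDS G S) (hS : ¬ IsMTDS G S) :
    ∃ v ∈ S, IsTDS G (S.erase v) := by
  simp only [IsMTDS, not_and, not_forall, not_not] at hS
  obtain ⟨T, hTS, hT⟩ := hS h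
  obtain ⟨v, hvS, hvT⟩ := Finset.exists_of_ssubset hTS
  exact ⟨v, hvS, hT.mono fun x hx => Finset.mem_erase.2
    ⟨fun e => hvT (e ▸ hx), hTS.1 hx⟩⟩

theorem kTotalDomGraph_adj_erase [DecidableEq V]
    (A B : {S : Finset V // IsTDS G S ∧ S.card ≤ k}) {v : V} (hv : v ∈ A.1)
    (hB : B.1 = A.1.erase v) : (kTotalDomGraph G k).Adj A B :=
  ⟨v, Or.inr ⟨by simp [hB], by rw [hB, Finset.insert_erase hv]⟩⟩

/-- The `k`-total dominating graph is connected if every vertex other than `C` can be joined to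
one on which `φ` is smaller. -/
theorem kTotalDomGraph_connected_of_descent [DecidableEq V]
    (C : {S : Finset V // IsTDS G S ∧ S.card ≤ k}) (φ : Finset V → ℕ)
    (h : ∀ A : {S : Finset V // IsTDS G S ∧ S.card ≤ k}, A ≠ C →
      ∃ B, (kTotalDomGraph G k).Reachable A B ∧ φ B.1 < φ A.1) :
    (kTotalDomGraph G k).Connected := by
  have key : ∀ m, ∀ A : {S : Finset V // IsTDS G S ∧ S.card ≤ k}, φ A.1 = m →
      (kTotalDomGraph G k).Reachable A C := by
    intro m
    induction m using Nat.strong_induction_on with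
    | _ m ih =>
      intro A hA
      by_cases hAC : A = C
      · rw [hAC]
      · obtain ⟨B, hAB, hlt⟩ := h A hAC
        exact hAB.trans (ih _ (hA ▸ hlt) B rfl)
  have : Nonempty {S : Finset V // IsTDS G S ∧ S.card ≤ k} := ⟨C⟩
  exact ⟨fun A B => (key _ A rfl).trans (key _ B rfl).symm⟩

/-- A minimal total dominating set of cardinality `k` is an isolated vertex of the `k`-total
dominating graph. -/
theorem IsMTDS.not_adj [DecidableEq V] {A : {S : Finset V // IsTDS G S ∧ S.card ≤ k}}
    (hA : IsMTDS G A.1) (hk : A.1.card = k) (B : {S : Finset V // IsTDS G S ∧ S.card ≤ k}) :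
    ¬ (kTotalDomGraph G k).Adj A B := by
  rintro ⟨v, ⟨hv, hB⟩ | ⟨hv, hB⟩⟩
  · have := B.2.2
    rw [hB, Finset.card_insert_of_notMem hv] at this
    omega
  · exact hA.2 B.1 (hB ▸ Finset.ssubset_insert hv) B.2.1

theorem not_connected_upperTotalDomNum [Fintype V] [DecidableEq V] {A B : Finset V}
    (hA : IsMTDS G A) (hB : IsMTDS G B) (hAB : A ≠ B) :
    ¬ (kTotalDomGraph G (upperTotalDomNum G)).Connected := by
  intro hconn
  obtain ⟨S, hS, hcard⟩ :=
    (upperTotalDomNum_isGreatest G fun v => (hA.1 v).imp fun _ hu => hu.2).1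
  -- A second vertex is essential: a graph with a single vertex is connected.
  obtain ⟨T, hT, hTS⟩ : ∃ T, IsMTDS G T ∧ T ≠ S := by
    by_cases h : A = S
    · exact ⟨B, hB, fun e => hAB (h.trans e.symm)⟩
    · exact ⟨A, hA, h⟩
  let s : {S : Finset V // IsTDS G S ∧ S.card ≤ upperTotalDomNum G} := ⟨S, hS.1, hcard.le⟩
  let t : {S : Finset V // IsTDS G S ∧ S.card ≤ upperTotalDomNum G} :=
    ⟨T, hT.1, hT.card_le_upperTotalDomNum⟩
  have : Nontrivial {S : Finset V // IsTDS G S ∧ S.card ≤ upperTotalDomNum G} :=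
    ⟨⟨t, s, fun e => hTS (congrArg Subtype.val e)⟩⟩
  obtain ⟨u, hu⟩ := hconn.preconnected.exists_adj_of_nontrivial s
  exact IsMTDS.not_adj (A := s) hS hcard u hu

theorem dZero_eq_of_connected_of_not_connected [Fintype V] [DecidableEq V] {d : ℕ}
    (h : ∀ k, d + 1 ≤ k → (kTotalDomGraph G k).Connected)
    (h' : ¬ (kTotalDomGraph G d).Connected) : dZero G = d + 1 := by
  refine IsLeast.csInf_eq ⟨h, fun l hl => ?_⟩
  by_contra hlt
  exact h' (hl d (by omega))

/-- If some total dominating set is contained in all others, then it determines both `Γ_t`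
and `d₀`. -/
theorem dZero_eq_card_of_least [Fintype V] [DecidableEq V] (hS : IsTDS G S)
    (hle : ∀ T, IsTDS G T → S ⊆ T) (hpos : S.Nonempty) :
    dZero G = S.card ∧ upperTotalDomNum G = S.card := by
  constructor
  · obtain ⟨d, hd⟩ := Nat.exists_eq_succ_of_ne_zero hpos.card_pos.ne'
    rw [hd]
    refine dZero_eq_of_connected_of_not_connected (fun k hk => ?_) fun hconn => ?_
    · refine kTotalDomGraph_connected_of_descent ⟨S, hS, hd.le.trans hk⟩ Finset.card
        fun A hA => ?_
      have hss : S ⊂ A.1 := (hle _ A.2.1).ssubset_of_ne fun e => hA (Subtype.ext e.symm)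
      obtain ⟨v, hv, hvS⟩ := Finset.exists_of_ssubset hss
      have hlt := Finset.card_erase_lt_of_mem hv
      refine ⟨⟨A.1.erase v, hS.mono fun x hx => Finset.mem_erase.2
        ⟨fun e => hvS (e ▸ hx), hss.1 hx⟩, hlt.le.trans A.2.2⟩,
        (kTotalDomGraph_adj_erase _ _ hv rfl).reachable, hlt⟩
    -- For `k = S.card - 1` there is no vertex at all, and the empty graph is not connected.
    · obtain ⟨A⟩ := hconn.nonempty
      have := Finset.card_le_card (hle _ A.2.1)
      have := A.2.2
      omega
  · refine IsGreatest.csSup_eq ⟨⟨S, ⟨hS, fun T hT h => hT.2 (hle T h)⟩, rfl⟩, ?_⟩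
    rintro _ ⟨T, hT, rfl⟩
    by_contra hlt
    refine hT.2 S ((hle T hT.1).ssubset_of_ne fun e => hlt (by rw [e])) hS

end General

/-! ### Total dominating sets of paths -/

section Path

variable {n : ℕ} {S : Finset (Fin n)}

theorem isTDS_pathGraph_iff : IsTDS (pathGraph n) S ↔
    ∀ i < n, ∃ u ∈ S, i + 1 = u.val ∨ u.val + 1 = i := by
  simp only [IsTDS, pathGraph_adj, Fin.forall_iff]

/-- The total dominating set of `P_n` whose elements are pushed as far to the right as possible. -/
def rightmostTDS (n : ℕ) : Finset (Fin n) :=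
  Finset.univ.filter fun i => i.val % 4 = 1 ∨ i.val % 4 = 2 ∨ i.val + 2 = n

theorem mem_rightmostTDS {i : Fin n} :
    i ∈ rightmostTDS n ↔ i.val % 4 = 1 ∨ i.val % 4 = 2 ∨ i.val + 2 = n := by
  simp [rightmostTDS]

theorem isTDS_rightmostTDS (hn : 2 ≤ n) : IsTDS (pathGraph n) (rightmostTDS n) := by
  rw [isTDS_pathGraph_iff]
  intro i hi
  by_cases h : i + 1 < n ∧ ((i + 1) % 4 = 1 ∨ (i + 1) % 4 = 2)
  · exact ⟨⟨i + 1, h.1⟩, mem_rightmostTDS.2 (by simp only; omega), Or.inl rfl⟩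
  · exact ⟨⟨i - 1, by omega⟩, mem_rightmostTDS.2 (by simp only; omega),
      Or.inr (by simp only; omega)⟩

/-- At the first place where a total dominating set `S` of `P_n` differs from the rightmost one,
`S` has an element that can be either removed or moved two places to the right. -/
theorem exists_shift (hS : IsTDS (pathGraph n) S) (hne : S ≠ rightmostTDS n) :
    ∃ i ∈ S, IsTDS (pathGraph n) (S.erase i) ∨
      ∃ j ∉ S, i < j ∧ IsTDS (pathGraph n) ((insert j S).erase i) := by
  have hex : ∃ m, ∃ h : m < n, ¬ (⟨m, h⟩ ∈ S ↔ ⟨m, h⟩ ∈ rightmostTDS n) := by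
    by_contra! hall
    exact hne (Finset.ext fun i => hall i.1 i.2)
  classical
  obtain ⟨hm, hdiff⟩ := Nat.find_spec hex
  have hmin : ∀ l, ∀ h : l < n, l < Nat.find hex →
      (⟨l, h⟩ ∈ S ↔ (l % 4 = 1 ∨ l % 4 = 2 ∨ l + 2 = n)) := by
    intro l hl hlt
    have := Nat.find_min hex hlt
    push Not at this
    rw [this hl, mem_rightmostTDS]
  generalize Nat.find hex = m at hm hdiff hmin
  rw [mem_rightmostTDS] at hdiff
  rw [isTDS_pathGraph_iff] at hS
  -- A missing `m` would leave `m + 1` undominated if `m + 2 = n`; otherwise it would leave `m - 1`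
  -- undominated, since `S` agrees with the rightmost set at `m - 2`, which that set omits.
  have hmS : (⟨m, hm⟩ : Fin n) ∈ S := by
    by_contra hnot
    have hm4 : m % 4 = 1 ∨ m % 4 = 2 ∨ m + 2 = n := by
      by_contra h
      exact hdiff ⟨fun h' => absurd h' hnot, fun h' => absurd h' h⟩
    by_cases hlast : m + 2 = n
    · obtain ⟨⟨u, hu⟩, huS, h⟩ := hS (m + 1) (by omega)
      simp only at h
      obtain rfl : u = m := by omega
      exact hnot huS
    · obtain ⟨⟨u, hu⟩, huS, h⟩ := hS (m - 1) (by omega)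
      simp only at h
      rcases Nat.lt_trichotomy u m with hlt | rfl | hgt
      · rw [hmin u hu hlt] at huS
        omega
      · exact hnot huS
      · omega
  have hm4 : ¬ (m % 4 = 1 ∨ m % 4 = 2 ∨ m + 2 = n) := fun h => hdiff ⟨fun _ => h, fun _ => hmS⟩
  -- The left neighbour of `m` is already dominated by `m - 2`, so only `m + 1` can depend on `m`,
  -- and `m + 2` serves it equally well.
  have hleft : ∀ l, l + 1 = m → ∃ u ∈ S, u.val + 1 = l := fun l hl =>
    ⟨⟨m - 2, by omega⟩, (hmin _ _ (by omega)).2 (by omega), by simp only; omega⟩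
  refine ⟨⟨m, hm⟩, hmS, ?_⟩
  -- Vacuously true for `m = n - 1`, which has no right neighbour to dominate.
  by_cases hnext : ∀ h : m + 2 < n, (⟨m + 2, h⟩ : Fin n) ∈ S
  · left
    rw [isTDS_pathGraph_iff]
    intro i hi
    by_cases h1 : i + 1 = m
    · obtain ⟨u, hu, hui⟩ := hleft i h1
      exact ⟨u, Finset.mem_erase.2 ⟨fun e => by simp [e] at hui; omega, hu⟩, Or.inr hui⟩
    by_cases h2 : i = m + 1
    · exact ⟨⟨m + 2, by omega⟩, Finset.mem_erase.2 ⟨by simp, hnext _⟩, Or.inl (by simp only; omega)⟩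
    obtain ⟨u, hu, hui⟩ := hS i hi
    exact ⟨u, Finset.mem_erase.2 ⟨fun e => by simp [e] at hui; omega, hu⟩, hui⟩
  · right
    push Not at hnext
    obtain ⟨hm2, hnot⟩ := hnext
    refine ⟨⟨m + 2, hm2⟩, hnot, by simp, ?_⟩
    rw [isTDS_pathGraph_iff]
    intro i hi
    by_cases h1 : i + 1 = m
    · obtain ⟨u, hu, hui⟩ := hleft i h1
      exact ⟨u, Finset.mem_erase.2 ⟨fun e => by simp [e] at hui; omega,
        Finset.mem_insert_of_mem hu⟩, Or.inr hui⟩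
    by_cases h2 : i = m + 1
    · exact ⟨⟨m + 2, by omega⟩, Finset.mem_erase.2 ⟨by simp, Finset.mem_insert_self _ _⟩,
        Or.inl (by simp only; omega)⟩
    obtain ⟨u, hu, hui⟩ := hS i hi
    exact ⟨u, Finset.mem_erase.2 ⟨fun e => by simp [e] at hui; omega,
      Finset.mem_insert_of_mem hu⟩, hui⟩

theorem kTotalDomGraph_pathGraph_connected (hn : 2 ≤ n) {k : ℕ}
    (hk : upperTotalDomNum (pathGraph n) + 1 ≤ k) :
    (kTotalDomGraph (pathGraph n) k).Connected := by
  -- The weights `n - x` are positive and decrease to the right, so deletions and right shifts both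
  -- lower their sum.
  have herase : ∀ (S : Finset (Fin n)) (i : Fin n), i ∈ S →
      ∑ x ∈ S.erase i, (n - x.val) + (n - i.val) = ∑ x ∈ S, (n - x.val) :=
    fun S i hi => Finset.sum_erase_add S _ hi
  have hdesc : ∀ A : {S : Finset (Fin n) // IsTDS (pathGraph n) S ∧ S.card ≤ k},
      A.1 ≠ rightmostTDS n → ∃ B, (kTotalDomGraph (pathGraph n) k).Reachable A B ∧
        ∑ x ∈ B.1, (n - x.val) < ∑ x ∈ A.1, (n - x.val) := by
    intro A hA
    have hrem : ∀ i ∈ A.1, IsTDS (pathGraph n) (A.1.erase i) →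
        ∃ B, (kTotalDomGraph (pathGraph n) k).Reachable A B ∧
          ∑ x ∈ B.1, (n - x.val) < ∑ x ∈ A.1, (n - x.val) := fun i hi h => by
      refine ⟨⟨A.1.erase i, h, (Finset.card_erase_lt_of_mem hi).le.trans A.2.2⟩,
        (kTotalDomGraph_adj_erase _ _ hi rfl).reachable, ?_⟩
      have := herase A.1 i hi
      have := i.2
      simp only
      omega
    by_cases hmin : IsMTDS (pathGraph n) A.1
    · have hcard := hmin.card_le_upperTotalDomNum
      obtain ⟨i, hi, h | ⟨j, hj, hij, h⟩⟩ := exists_shift A.2.1 hA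
      · exact hrem i hi h
      · have hins := Finset.card_insert_of_notMem hj
        let M : {S : Finset (Fin n) // IsTDS (pathGraph n) S ∧ S.card ≤ k} :=
          ⟨insert j A.1, A.2.1.mono (Finset.subset_insert _ _), by omega⟩
        have hiM : i ∈ M.1 := Finset.mem_insert_of_mem hi
        have hlt := Finset.card_erase_lt_of_mem hiM
        refine ⟨⟨M.1.erase i, h, hlt.le.trans M.2.2⟩,
          (Adj.reachable ?_).symm.trans (kTotalDomGraph_adj_erase M _ hiM rfl).reachable, ?_⟩
        · exact kTotalDomGraph_adj_erase M A (Finset.mem_insert_self j _)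
            (Finset.erase_insert hj).symm
        · have h1 := herase M.1 i hiM
          have h2 : ∑ x ∈ M.1, (n - x.val) = (n - j.val) + ∑ x ∈ A.1, (n - x.val) :=
            Finset.sum_insert hj
          have := i.2
          have : i.val < j.val := hij
          simp only
          omega
    · obtain ⟨i, hi, h⟩ := A.2.1.exists_erase hmin
      exact hrem i hi h
  obtain ⟨T, -, hT⟩ := (isTDS_rightmostTDS hn).exists_isMTDS_subset
  -- A set of least weight among the vertices admits no descent, so it is the rightmost set, which
  -- therefore has at most `k` elements.
  have hC : (rightmostTDS n).card ≤ k := by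
    have : Nonempty {S : Finset (Fin n) // IsTDS (pathGraph n) S ∧ S.card ≤ k} :=
      ⟨T, hT.1, by have := hT.card_le_upperTotalDomNum; omega⟩
    let φ : {S : Finset (Fin n) // IsTDS (pathGraph n) S ∧ S.card ≤ k} → ℕ :=
      fun A => ∑ x ∈ A.1, (n - x.val)
    by_contra hlt
    obtain ⟨B, -, hB⟩ := hdesc (Function.argmin φ) fun e => hlt (e ▸ (Function.argmin φ).2.2)
    exact Function.not_lt_argmin φ B hB
  exact kTotalDomGraph_connected_of_descent ⟨rightmostTDS n, isTDS_rightmostTDS hn, hC⟩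
    (fun S => ∑ x ∈ S, (n - x.val)) fun A hA => hdesc A fun e => hA (Subtype.ext e)

/-- Only `1` and `n - 2` are the sole neighbour of some vertex, namely of a leaf. -/
theorem isTDS_univ_erase_pathGraph (hn : 2 ≤ n) {i : Fin n} (h1 : i.val ≠ 1)
    (h2 : i.val + 2 ≠ n) : IsTDS (pathGraph n) (Finset.univ.erase i) := by
  rw [isTDS_pathGraph_iff]
  intro v hv
  by_cases h : v + 1 < n ∧ v + 1 ≠ i.val
  · exact ⟨⟨v + 1, h.1⟩, by simpa [Fin.ext_iff] using h.2, Or.inl rfl⟩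
  · exact ⟨⟨v - 1, by omega⟩, by simp [Fin.ext_iff]; omega, Or.inr (by simp only; omega)⟩

theorem exists_isMTDS_ne_pathGraph (hn : n = 3 ∨ 5 ≤ n) :
    ∃ A B, IsMTDS (pathGraph n) A ∧ IsMTDS (pathGraph n) B ∧ A ≠ B := by
  obtain ⟨A, -, hA⟩ := (isTDS_rightmostTDS (n := n) (by omega)).exists_isMTDS_subset
  -- Here `i` is `0` or `2`, hence neither `1` nor `n - 2` because `n ≠ 2, 4`; some minimal set
  -- avoids it.
  obtain ⟨i, hi, hin⟩ := isTDS_pathGraph_iff.1 hA.1 1 (by omega)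
  obtain ⟨B, hBi, hB⟩ := (isTDS_univ_erase_pathGraph (i := i) (by omega)
    (by omega) (by omega)).exists_isMTDS_subset
  refine ⟨A, B, hA, hB, ?_⟩
  rintro rfl
  exact absurd (hBi hi) (Finset.notMem_erase _ _)

/-- The leaves force `1` and `n - 2` into every total dominating set, and for these `n` the two
suffice. -/
theorem dZero_pathGraph_two_four (hn : n = 2 ∨ n = 4) :
    dZero (pathGraph n) = 2 ∧ upperTotalDomNum (pathGraph n) = 2 := by
  have h1 : 1 < n := by omega
  have h2 : n - 2 < n := by omega
  have hcard : ({⟨1, h1⟩, ⟨n - 2, h2⟩} : Finset (Fin n)).card = 2 :=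
    Finset.card_pair (by simp [Fin.ext_iff]; omega)
  have key := dZero_eq_card_of_least (G := pathGraph n) (S := {⟨1, h1⟩, ⟨n - 2, h2⟩}) ?_ ?_
    (Finset.insert_nonempty _ _)
  · rwa [hcard] at key
  · rw [isTDS_pathGraph_iff]
    intro i hi
    simp only [Finset.mem_insert, Finset.mem_singleton, exists_eq_or_imp, exists_eq_left]
    omega
  · intro T hT
    rw [isTDS_pathGraph_iff] at hT
    obtain ⟨u, hu, hu'⟩ := hT 0 (by omega)
    obtain ⟨w, hw, hw'⟩ := hT (n - 1) (by omega)
    obtain rfl : u = ⟨1, h1⟩ := Fin.ext (by simp only; omega)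
    obtain rfl : w = ⟨n - 2, h2⟩ := Fin.ext (by have := w.2; simp only; omega)
    exact Finset.insert_subset hu (Finset.singleton_subset_iff.2 hw)

end Path

end TotalDom

theorem theorem3p7 :
    (TotalDom.dZero (SimpleGraph.pathGraph 2) = 2 ∧
      TotalDom.upperTotalDomNum (SimpleGraph.pathGraph 2) = 2 ∧
      TotalDom.dZero (SimpleGraph.pathGraph 4) = 2 ∧
      TotalDom.upperTotalDomNum (SimpleGraph.pathGraph 4) = 2) ∧
    ∀ n : ℕ, (n = 3 ∨ 5 ≤ n) →
      TotalDom.dZero (SimpleGraph.pathGraph n) =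
        TotalDom.upperTotalDomNum (SimpleGraph.pathGraph n) + 1 := by
  obtain ⟨h2, h2'⟩ := TotalDom.dZero_pathGraph_two_four (Or.inl rfl)
  obtain ⟨h4, h4'⟩ := TotalDom.dZero_pathGraph_two_four (Or.inr rfl)
  refine ⟨⟨h2, h2', h4, h4'⟩, fun n hn => ?_⟩
  obtain ⟨A, B, hA, hB, hAB⟩ := TotalDom.exists_isMTDS_ne_pathGraph hn
  exact TotalDom.dZero_eq_of_connected_of_not_connected
    (fun _ hk => TotalDom.kTotalDomGraph_pathGraph_connected (by omega) hk)
    (TotalDom.not_connected_upperTotalDomNum hA hB hAB)
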